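/- For subsets $A,B$ of a finite abelian group $G$ (written additively), let $\Delta(A,B)$ be the multiset $\{x-y : x\in A,\ y\in B\}$. Let $G$ have order $v$, let $\lambda_1,\dots,\lambda_r$ be positive integers, and let $D_1,\dots,D_r$ be mutually disjoint subsets of $G$ with $|D_i|=k_i$. The family $\{D_1,\dots,D_r\}$ is called a $(v,r;k_1,\dots,k_r;\lambda_1,\dots,\lambda_r)$-GSEDF (generalized strong external difference family) in $G$ if, for every $1\le i\le r$, the multiset equation $\bigcup_{j\neq i}\Delta(D_i,D_j)=\lambda_i\,(G\setminus\{0\})$ holds, where multiplicities are added in the union; that is, every nonzero element of $G$ occurs exactly $\lambda_i$ times on the left, and $0$ does not occur. Such a GSEDF is said to exist if it exists in some abelian group of order $v$. Theorem. Let $m\ge 1$ be an integer. Let $t=1$ and $n=0$, or let $t=p_1p_2\cdots p_n$ where $p_1,\dots,p_n$ are odd integers greater than $1$ (not necessarily prime or distinct). Suppose that $4m-1$ is a prime power, or that $4m-1=q(q+2)$ where both $q$ and $q+2$ are prime powers. Then there exists a $\left((4m-1)t,\,2;\ m\cdot 2^{n+1},\ \frac{4mt-t-1}{2};\ m\cdot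 2^{n},\ m\cdot 2^{n}\right)$-GSEDF. -/

import Mathlib

/-- The multiset of differences `Δ(A, B) = {x - y : x ∈ A, y ∈ B}`, counted with multiplicity. -/
def diffMultiset {G : Type*} [AddCommGroup G] (A B : Finset G) : Multiset G :=
  (A ×ˢ B).val.map (fun p => p.1 - p.2)

/-- `D 0, …, D (m - 1)` is a `(v, m; k₁, …, kₘ; lam₁, …, lamₘ)`-generalized strong external
difference family in the finite abelian group `G`. The union of multisets in the defining
equation adds multiplicities. -/
structure IsGSEDF {G : Type*} [AddCommGroup G] [Fintype G] [DecidableEq G]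
    (v m : ℕ) (k lam : Fin m → ℕ) (D : Fin m → Finset G) : Prop where
  card_group : Fintype.card G = v
  lam_pos : ∀ i, 0 < lam i
  disjoint : ∀ i j, i ≠ j → Disjoint (D i) (D j)
  card_block : ∀ i, (D i).card = k i
  diff_eq : ∀ i, ∑ j ∈ Finset.univ.erase i, diffMultiset (D i) (D j)
    = lam i • (Finset.univ.erase (0 : G)).val

/-- A `(v, m; k₁, …, kₘ; lam₁, …, lamₘ)`-GSEDF exists in some abelian group. -/
def GSEDFExists (v m : ℕ) (k lam : Fin m → ℕ) : Prop :=
  ∃ (G : Type) (_ : AddCommGroup G) (_ : Fintype G) (_ : DecidableEq G) (D : Fin m → Finset G),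
    IsGSEDF v m k lam D

/-!
Call a finite set `A` and a sign function `f` on a group *delta-correlated* if `f = 1` on `A` and
`∑ a ∈ A, f (a - g) = 0` for all `g ≠ 0`. For such a pair half of the values `f (a - g)`, `a ∈ A`,
are `-1` whenever `g ≠ 0`, and none is when `g = 0`, so `A` and `{f = -1}` form a two-block GSEDF.
Delta-correlated pairs multiply: `(A, f)` and `(C, s)` give `(A × C, (x, y) ↦ f x * s y)`. It
remains to find the factors. In `ZMod p` with `p` odd, take `C = {0, -1}` and `s k = (-1) ^ k`,
using the residue `k ∈ [0, p)`; since `p` is odd, `s` changes sign between any two cyclically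
consecutive elements except `-1` and `0`. In order `4 m - 1`, take `A = {f = 1}` where `f` has sum
`1` and off-peak autocorrelations `-1`: such `f` are obtained from quadratic characters by
correcting their zeros (the Paley and the twin prime power difference sets).
-/

open Finset

section DiffMultiset

variable {G : Type*} [AddCommGroup G] [DecidableEq G] {A B : Finset G} {lam : ℕ}

theorem count_diffMultiset (A B : Finset G) (g : G) :
    (diffMultiset A B).count g = #{a ∈ A | a - g ∈ B} := by
  rw [diffMultiset, Multiset.count_map, ← filter_val, card_val]
  refine card_bij' (fun p _ => p.1) (fun a _ => (a, a - g)) ?_ ?_ ?_ ?_ <;>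
    simp +contextual [sub_sub_cancel]

theorem count_neg_diffMultiset (A B : Finset G) (g : G) :
    (diffMultiset A B).count (-g) = (diffMultiset B A).count g := by
  rw [count_diffMultiset, count_diffMultiset]
  refine card_bij' (fun a _ => a + g) (fun b _ => b - g) ?_ ?_ ?_ ?_ <;> simp +contextual

variable [Fintype G]

theorem count_nsmul_univ_erase_zero (lam : ℕ) (g : G) :
    (lam • (univ.erase (0 : G)).val).count g = if g = 0 then 0 else lam := by
  rw [Multiset.count_nsmul, Multiset.count_eq_of_nodup (nodup _)]
  simp only [← mem_def, mem_erase, mem_univ, and_true, ite_not, mul_ite, mul_one, mul_zero]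

theorem diffMultiset_swap_eq_nsmul (h : diffMultiset A B = lam • (univ.erase (0 : G)).val) :
    diffMultiset B A = lam • (univ.erase (0 : G)).val := by
  ext g
  simp only [← count_neg_diffMultiset A B, h, count_nsmul_univ_erase_zero, neg_eq_zero]

theorem disjoint_of_diffMultiset_eq_nsmul
    (h : diffMultiset A B = lam • (univ.erase (0 : G)).val) : Disjoint A B := by
  have h_zero : #{a ∈ A | a - 0 ∈ B} = 0 := by
    rw [← count_diffMultiset, h, count_nsmul_univ_erase_zero, if_pos rfl]
  simpa [filter_eq_empty_iff, disjoint_left] using h_zero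

theorem isGSEDF_pair (hlam : 0 < lam) (h : diffMultiset A B = lam • (univ.erase (0 : G)).val) :
    IsGSEDF (Fintype.card G) 2 ![#A, #B] ![lam, lam] ![A, B] where
  card_group := rfl
  lam_pos := by simpa [Fin.forall_fin_two] using hlam
  disjoint := by
    have hAB := disjoint_of_diffMultiset_eq_nsmul h
    simpa [Fin.forall_fin_two] using ⟨hAB, hAB.symm⟩
  card_block := by simp [Fin.forall_fin_two]
  diff_eq := by
    have erase_zero : univ.erase (0 : Fin 2) = {1} := by decide
    have erase_one : univ.erase (1 : Fin 2) = {0} := by decide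
    simpa [Fin.forall_fin_two, erase_zero, erase_one] using
      ⟨h, diffMultiset_swap_eq_nsmul h⟩

end DiffMultiset

section SignSum

variable {ι : Type*} {s : Finset ι} {f : ι → ℤ}

theorem two_mul_sum_filter_eq_one (hf : ∀ i ∈ s, IsUnit (f i)) (u : ι → ℤ) :
    2 * ∑ i ∈ s with f i = 1, u i = ∑ i ∈ s, (1 + f i) * u i := by
  rw [sum_filter, mul_sum]
  refine sum_congr rfl fun i hi => ?_
  rcases Int.isUnit_iff.mp (hf i hi) with h | h <;> simp [h]

theorem two_mul_card_filter_eq_one (hf : ∀ i ∈ s, IsUnit (f i)) :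
    2 * (#{i ∈ s | f i = 1} : ℤ) = #s + ∑ i ∈ s, f i := by
  simpa [sum_add_distrib] using two_mul_sum_filter_eq_one hf 1

theorem two_mul_card_filter_eq_neg_one (hf : ∀ i ∈ s, IsUnit (f i)) :
    2 * (#{i ∈ s | f i = -1} : ℤ) = #s - ∑ i ∈ s, f i := by
  simpa [neg_eq_iff_eq_neg, sub_eq_add_neg] using
    two_mul_card_filter_eq_one (f := fun i => -f i) fun i hi => (hf i hi).neg

end SignSum

/-- The external product `(x, y) ↦ f x * g y` of functions on two types. -/
def externalProduct {α β R : Type*} [Mul R] (f : α → R) (g : β → R) : α × β → R :=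
  fun x => f x.1 * g x.2

theorem sum_externalProduct {α β R : Type*} [Fintype α] [Fintype β]
    [NonUnitalNonAssocSemiring R] (f : α → R) (g : β → R) :
    ∑ x, externalProduct f g x = (∑ x, f x) * ∑ y, g y := by
  simp only [externalProduct, Fintype.sum_prod_type, Fintype.sum_mul_sum]

/-- The set `A` and the sign function `f` are delta-correlated: the cross-correlation
`g ↦ ∑ a ∈ A, f (a - g)` equals `#A` at `0` (equivalently, `f = 1` on `A`) and vanishes elsewhere.
Signs are encoded as units of `ℤ`. -/
structure HasDeltaCorrelation {G : Type*} [AddGroup G] (A : Finset G) (f : G → ℤ) : Prop where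
  isUnit : ∀ x, IsUnit (f x)
  eq_one : ∀ a ∈ A, f a = 1
  sum_sub_eq_zero : ∀ g ≠ 0, ∑ a ∈ A, f (a - g) = 0

namespace HasDeltaCorrelation

section AddGroup

variable {G H : Type*} [AddGroup G] [AddGroup H] {A : Finset G} {f : G → ℤ}

theorem sum_eq_card (h : HasDeltaCorrelation A f) : ∑ a ∈ A, f a = #A := by
  rw [sum_congr rfl h.eq_one, sum_const, nsmul_one]

theorem prod (h : HasDeltaCorrelation A f) {C : Finset H} {s : H → ℤ}
    (hs : HasDeltaCorrelation C s) :
    HasDeltaCorrelation (A ×ˢ C) (externalProduct f s) where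
  isUnit x := (h.isUnit x.1).mul (hs.isUnit x.2)
  eq_one := by
    rintro ⟨a, c⟩ hac
    obtain ⟨ha, hc⟩ := mem_product.mp hac
    rw [externalProduct, h.eq_one a ha, hs.eq_one c hc, one_mul]
  sum_sub_eq_zero := by
    rintro ⟨g, k⟩ hgk
    simp only [externalProduct, Prod.fst_sub, Prod.snd_sub, sum_product, ← sum_mul_sum]
    by_cases hg : g = 0
    · have hk : k ≠ 0 := fun hk => hgk (Prod.mk_eq_zero.mpr ⟨hg, hk⟩)
      rw [hs.sum_sub_eq_zero k hk, mul_zero]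
    · rw [h.sum_sub_eq_zero g hg, zero_mul]

theorem sum_univ_eq_one [Fintype G] (h : HasDeltaCorrelation A f) (hA : A.Nonempty) :
    ∑ x, f x = 1 := by
  have card_mul_sum : (#A : ℤ) * ∑ x, f x = #A := calc
    (#A : ℤ) * ∑ x, f x = ∑ a ∈ A, ∑ g, f (a - g) := by
      simp only [(Equiv.subLeft _).sum_comp f, ← Equiv.subLeft_apply, sum_const, nsmul_eq_mul]
    _ = ∑ g, ∑ a ∈ A, f (a - g) := sum_comm
    _ = ∑ a ∈ A, f (a - 0) := Fintype.sum_eq_single 0 h.sum_sub_eq_zero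
    _ = #A := by simpa only [sub_zero] using h.sum_eq_card
  have card_ne_zero : (#A : ℤ) ≠ 0 := by exact_mod_cast hA.card_ne_zero
  exact (mul_eq_left₀ card_ne_zero).mp card_mul_sum

theorem two_mul_card_add_one [Fintype G] (h : HasDeltaCorrelation A f) (hA : A.Nonempty) :
    2 * #{x | f x = -1} + 1 = Fintype.card G := by
  have := two_mul_card_filter_eq_neg_one (s := univ) fun x _ => h.isUnit x
  rw [h.sum_univ_eq_one hA, card_univ] at this
  omega

end AddGroup

variable {G : Type*} [AddCommGroup G] [Fintype G] [DecidableEq G] {A : Finset G} {f : G → ℤ}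
  {lam : ℕ}

theorem diffMultiset_eq_nsmul (h : HasDeltaCorrelation A f) (hA : #A = 2 * lam) :
    diffMultiset A {x | f x = -1} = lam • (univ.erase (0 : G)).val := by
  ext g
  rw [count_diffMultiset, count_nsmul_univ_erase_zero]
  have two_mul_count := two_mul_card_filter_eq_neg_one (s := A) fun a _ => h.isUnit (a - g)
  simp only [mem_filter_univ]
  split_ifs with hg
  · simp only [hg, sub_zero, h.sum_eq_card] at two_mul_count ⊢
    omega
  · rw [h.sum_sub_eq_zero g hg] at two_mul_count
    omega

theorem isGSEDF (h : HasDeltaCorrelation A f) (hA : #A = 2 * lam) (hlam : 0 < lam) :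
    IsGSEDF (Fintype.card G) 2 ![2 * lam, (Fintype.card G - 1) / 2] ![lam, lam]
      ![A, ({x | f x = -1} : Finset G)] := by
  have hcard := h.two_mul_card_add_one (card_pos.mp (by omega))
  rw [← hA, show (Fintype.card G - 1) / 2 = #{x | f x = -1} by omega]
  exact isGSEDF_pair hlam (h.diffMultiset_eq_nsmul hA)

end HasDeltaCorrelation

section ZMod

variable {p : ℕ} [Fact (1 < p)]

theorem neg_one_pow_val_add_neg_one_pow_val_sub_one {k : ZMod p} (hk : k ≠ 0) :
    (-1 : ℤ) ^ k.val + (-1) ^ (k - 1).val = 0 := by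
  have one_le_val : 1 ≤ k.val := Nat.one_le_iff_ne_zero.mpr ((ZMod.val_ne_zero k).mpr hk)
  have val_sub_one : (k - 1).val = k.val - 1 := by
    rw [ZMod.val_sub (by rwa [ZMod.val_one]), ZMod.val_one]
  rw [val_sub_one, ← Nat.sub_add_cancel one_le_val, pow_succ]
  simp

theorem hasDeltaCorrelation_zmod (hp : Odd p) :
    HasDeltaCorrelation ({0, -1} : Finset (ZMod p)) (fun k => (-1) ^ k.val) where
  isUnit k := isUnit_one.neg.pow k.val
  eq_one := by
    have val_neg_one : (-1 : ZMod p).val = p - 1 := by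
      rw [ZMod.neg_val, if_neg one_ne_zero, ZMod.val_one]
    simp [val_neg_one, (hp.tsub_odd odd_one).neg_one_pow]
  sum_sub_eq_zero g hg := by
    rw [sum_pair (neg_ne_zero.mpr one_ne_zero).symm, zero_sub, show -1 - g = -g - 1 by abel]
    exact neg_one_pow_val_add_neg_one_pow_val_sub_one (neg_ne_zero.mpr hg)

end ZMod

section Correlation

variable {G H R : Type*} [AddGroup G] [Fintype G] [AddGroup H] [Fintype H] [CommSemiring R]

/-- The cross-correlation `a ↦ ∑ x, f x * g (x - a)` of two functions on a finite group, as a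
bilinear map. -/
def correlation : (G → R) →ₗ[R] (G → R) →ₗ[R] (G → R) :=
  LinearMap.mk₂ R (fun f g a => ∑ x, f x * g (x - a))
    (fun _ _ _ => by ext; simp [add_mul, sum_add_distrib])
    (fun _ _ _ => by ext; simp [mul_sum, mul_assoc])
    (fun _ _ _ => by ext; simp [mul_add, sum_add_distrib])
    (fun _ _ _ => by ext; simp [mul_sum, mul_left_comm])

theorem correlation_apply (f g : G → R) (a : G) :
    correlation f g a = ∑ x, f x * g (x - a) := rfl

theorem correlation_one_left (g : G → R) (a : G) : correlation 1 g a = ∑ x, g x := by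
  simpa [correlation_apply] using (Equiv.subRight a).sum_comp g

theorem correlation_one_right (f : G → R) (a : G) : correlation f 1 a = ∑ x, f x := by
  simp [correlation_apply]

theorem correlation_single_left [DecidableEq G] (g : G → R) (a : G) :
    correlation (Pi.single 0 1) g a = g (-a) := by
  simp [correlation_apply, Pi.single_apply]

theorem correlation_single_right [DecidableEq G] (f : G → R) (a : G) :
    correlation f (Pi.single 0 1) a = f a := by
  simp [correlation_apply, Pi.single_apply, sub_eq_zero]

theorem correlation_externalProduct (f f' : G → R) (g g' : H → R) (a : G × H) :
    correlation (externalProduct f g) (externalProduct f' g') a =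
      correlation f f' a.1 * correlation g g' a.2 := by
  simp only [correlation_apply, ← sum_externalProduct]
  exact sum_congr rfl fun x _ => mul_mul_mul_comm _ _ _ _

theorem hasDeltaCorrelation_of_correlation_self {f : G → ℤ} (hf : ∀ x, IsUnit (f x))
    (hsum : ∑ x, f x = 1) (hcorr : ∀ g ≠ 0, correlation f f g = -1) :
    HasDeltaCorrelation ({x | f x = 1} : Finset G) f where
  isUnit := hf
  eq_one _ ha := by simpa using ha
  sum_sub_eq_zero g hg := by
    have hshift : ∑ x, f (x - g) = 1 := ((Equiv.subRight g).sum_comp f).trans hsum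
    have two_mul_sum := two_mul_sum_filter_eq_one (s := univ) (fun x _ => hf x) fun x => f (x - g)
    simp only [add_mul, one_mul, sum_add_distrib, hshift, ← correlation_apply, hcorr g hg]
      at two_mul_sum
    omega

end Correlation

section QuadraticChar

variable {F : Type*} [Field F] [Fintype F]

theorem ringChar_ne_two_of_odd_card (hF : Odd (Fintype.card F)) : ringChar F ≠ 2 := by
  rw [Ne, FiniteField.even_card_iff_char_two, Nat.odd_iff.mp hF]
  exact one_ne_zero

theorem correlation_mulChar_inv_of_ne_zero {R : Type*} [CommRing R] [IsDomain R] {χ : MulChar F R}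
    (hχ : χ ≠ 1) {a : F} (ha : a ≠ 0) : correlation χ ⇑χ⁻¹ a = -1 := by
  have summand (y : F) : χ (a * y) * χ⁻¹ (a * y - a) = χ (-1) * (χ y * χ⁻¹ (1 - y)) := by
    have neg_one_inv : χ⁻¹ (-1) = χ (-1) := by
      rw [MulChar.inv_apply', inv_neg_one]
    have mul_inv_apply : χ a * χ⁻¹ a = 1 := by
      rw [MulChar.inv_apply', ← map_mul, mul_inv_cancel₀ ha, map_one]
    rw [show a * y - a = a * (-1 * (1 - y)) by ring]
    simp only [map_mul, neg_one_inv]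
    linear_combination (χ y * χ (-1) * χ⁻¹ (1 - y)) * mul_inv_apply
  calc correlation χ ⇑χ⁻¹ a = ∑ y, χ (a * y) * χ⁻¹ (a * y - a) :=
        (Fintype.sum_equiv (Equiv.mulLeft₀ a ha) _ _ fun _ => rfl).symm
    _ = χ (-1) * jacobiSum χ χ⁻¹ := by simp only [summand, ← mul_sum, jacobiSum]
    _ = -1 := by
      rw [jacobiSum_nontrivial_inv hχ, mul_neg, ← map_mul, neg_one_mul, neg_neg, map_one]

theorem correlation_mulChar_inv_zero {R : Type*} [CommRing R] (χ : MulChar F R) :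
    correlation χ ⇑χ⁻¹ 0 = Fintype.card F - 1 := by
  classical
  simp only [correlation_apply, sub_zero, ← MulChar.mul_apply, mul_inv_cancel,
    MulChar.sum_one_eq_card_units, Fintype.card_units]
  exact Nat.cast_pred Fintype.card_pos

variable [DecidableEq F]

theorem correlation_quadraticChar (hF : ringChar F ≠ 2) (a : F) :
    correlation (quadraticChar F) (quadraticChar F) a =
      Fintype.card F * (Pi.single 0 1 : F → ℤ) a - 1 := by
  have hinv := (quadraticChar_isQuadratic F).inv
  by_cases ha : a = 0
  · have := correlation_mulChar_inv_zero (quadraticChar F)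
    rw [hinv] at this
    simp [ha, this]
  · have := correlation_mulChar_inv_of_ne_zero (quadraticChar_ne_one hF) ha
    rw [hinv] at this
    simp [ha, this]

theorem isUnit_quadraticChar {x : F} (hx : x ≠ 0) : IsUnit (quadraticChar F x) :=
  (isUnit_iff_ne_zero.mpr hx).map (quadraticChar F)

variable (F) in
/-- The quadratic character of a finite field, with value `1` instead of `0` at `0`. -/
def paleySign : F → ℤ := ⇑(quadraticChar F) + Pi.single 0 1

theorem isUnit_paleySign (x : F) : IsUnit (paleySign F x) := by
  by_cases hx : x = 0
  · simp [paleySign, hx]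
  · simpa [paleySign, hx] using isUnit_quadraticChar hx

theorem sum_paleySign (hF : ringChar F ≠ 2) : ∑ x, paleySign F x = 1 := by
  simp only [paleySign, Pi.add_apply, sum_add_distrib, quadraticChar_sum_zero hF, zero_add,
    Fintype.sum_pi_single']

theorem correlation_paleySign (hF : Fintype.card F % 4 = 3) {a : F} (ha : a ≠ 0) :
    correlation (paleySign F) (paleySign F) a = -1 := by
  have hchar : ringChar F ≠ 2 := ringChar_ne_two_of_odd_card (Nat.odd_iff.mpr (by omega))
  have hneg : quadraticChar F (-a) = -quadraticChar F a := by
    rw [neg_eq_neg_one_mul, map_mul, quadraticChar_neg_one hchar, ZMod.χ₄_nat_three_mod_four hF,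
      neg_one_mul]
  simp only [paleySign, map_add, LinearMap.add_apply, Pi.add_apply,
    correlation_quadraticChar hchar, correlation_single_left, correlation_single_right, hneg,
    Pi.single_eq_of_ne ha]
  ring

variable {K : Type*} [Field K] [Fintype K] [DecidableEq K]

variable (F K) in
/-- The product of the quadratic characters of `F` and `K`, with its zeros corrected to `1` at
`(0, y)` for `y ≠ 0` and to `-1` at `(x, 0)` for every `x`. If `#K = #F + 2`, these corrections add
up to `(#K - 1) - #F = 1`. -/
def twinSign : F × K → ℤ :=
  externalProduct (quadraticChar F) (quadraticChar K) + externalProduct (Pi.single 0 1) 1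
    - externalProduct 1 (Pi.single 0 1) - externalProduct (Pi.single 0 1) (Pi.single 0 1)

theorem isUnit_twinSign (x : F × K) : IsUnit (twinSign F K x) := by
  by_cases h₁ : x.1 = 0 <;> by_cases h₂ : x.2 = 0
  · simp [twinSign, externalProduct, h₁, h₂]
  · simp [twinSign, externalProduct, h₁, h₂]
  · simp [twinSign, externalProduct, h₁, h₂]
  · simpa [twinSign, externalProduct, h₁, h₂] using
      (isUnit_quadraticChar h₁).mul (isUnit_quadraticChar h₂)

theorem sum_twinSign (hF : ringChar F ≠ 2) (hK : Fintype.card K = Fintype.card F + 2) :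
    ∑ x, twinSign F K x = 1 := by
  simp only [twinSign, Pi.add_apply, Pi.sub_apply, sum_add_distrib, sum_sub_distrib,
    sum_externalProduct, quadraticChar_sum_zero hF, Fintype.sum_pi_single', Pi.one_apply,
    sum_const, card_univ, nsmul_one, hK]
  push_cast
  ring

theorem quadraticChar_neg_mul_quadraticChar_neg (hF : Odd (Fintype.card F))
    (hK : Fintype.card K = Fintype.card F + 2) (a : F) (b : K) :
    quadraticChar F (-a) * quadraticChar K (-b) = -(quadraticChar F a * quadraticChar K b) := by
  have hF2 : ringChar F ≠ 2 := ringChar_ne_two_of_odd_card hF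
  have hK2 : ringChar K ≠ 2 := ringChar_ne_two_of_odd_card (hK ▸ hF.add_even even_two)
  have card_mul_mod : (Fintype.card F * Fintype.card K) % 4 = 3 := by
    obtain ⟨k, hk⟩ := hF
    rw [hK, hk, show (2 * k + 1) * (2 * k + 1 + 2) = 4 * (k ^ 2 + 2 * k) + 3 by ring,
      Nat.mul_add_mod]
  have neg_one_mul_neg_one : quadraticChar F (-1) * quadraticChar K (-1) = -1 := by
    rw [quadraticChar_neg_one hF2, quadraticChar_neg_one hK2, ← map_mul, ← Nat.cast_mul,
      ZMod.χ₄_nat_three_mod_four card_mul_mod]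
  rw [neg_eq_neg_one_mul a, neg_eq_neg_one_mul b, map_mul, map_mul, mul_mul_mul_comm,
    neg_one_mul_neg_one, neg_one_mul]

theorem correlation_twinSign (hF : Odd (Fintype.card F))
    (hK : Fintype.card K = Fintype.card F + 2) {g : F × K} (hg : g ≠ 0) :
    correlation (twinSign F K) (twinSign F K) g = -1 := by
  have hF2 : ringChar F ≠ 2 := ringChar_ne_two_of_odd_card hF
  have hK2 : ringChar K ≠ 2 := ringChar_ne_two_of_odd_card (hK ▸ hF.add_even even_two)
  have hneg := quadraticChar_neg_mul_quadraticChar_neg hF hK g.1 g.2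
  have hcard : (Fintype.card K : ℤ) = Fintype.card F + 2 := mod_cast hK
  have single_mul_single : (Pi.single 0 1 : F → ℤ) g.1 * (Pi.single 0 1 : K → ℤ) g.2 = 0 := by
    contrapose! hg
    simpa [Prod.ext_iff, Pi.single_apply, and_comm] using hg
  simp only [twinSign, map_add, map_sub, LinearMap.add_apply, LinearMap.sub_apply, Pi.add_apply,
    Pi.sub_apply, correlation_externalProduct, correlation_quadraticChar hF2,
    correlation_quadraticChar hK2, correlation_one_left, correlation_one_right,
    correlation_single_right, correlation_single_left, quadraticChar_sum_zero hF2,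
    quadraticChar_sum_zero hK2, Fintype.sum_pi_single', Pi.one_apply, sum_const, card_univ,
    nsmul_one]
  -- The character part correlates with the corrections to `-(χ a * ψ b)` and, in the other order,
  -- to `-(χ (-a) * ψ (-b))`; these cancel by `hneg`.
  linear_combination
    ((Pi.single 0 1 : F → ℤ) g.1 - (Pi.single 0 1 : K → ℤ) g.2) * hcard - hneg +
      (Fintype.card F * Fintype.card K + 1) * single_mul_single

end QuadraticChar

/-- Some abelian group of order `v` has a `k`-element subset that is delta-correlated with some sign
function. -/
def DeltaCorrelationExists (v k : ℕ) : Prop :=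
  ∃ (G : Type) (_ : AddCommGroup G) (_ : Fintype G) (A : Finset G) (f : G → ℤ),
    Fintype.card G = v ∧ #A = k ∧ HasDeltaCorrelation A f

namespace DeltaCorrelationExists

theorem one : DeltaCorrelationExists 1 1 :=
  ⟨PUnit, inferInstance, inferInstance, univ, 1, rfl, rfl, fun _ => isUnit_one, fun _ _ => rfl,
    fun g hg => absurd (Subsingleton.elim g 0) hg⟩

theorem mul {v w k l : ℕ} (h : DeltaCorrelationExists v k) (h' : DeltaCorrelationExists w l) :
    DeltaCorrelationExists (v * w) (k * l) := by
  obtain ⟨G, _, _, A, f, rfl, rfl, hf⟩ := h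
  obtain ⟨H, _, _, C, s, rfl, rfl, hs⟩ := h'
  exact ⟨G × H, inferInstance, inferInstance, _, _, Fintype.card_prod G H, card_product A C,
    hf.prod hs⟩

theorem finset_prod {ι : Type*} (s : Finset ι) {v k : ι → ℕ}
    (h : ∀ i ∈ s, DeltaCorrelationExists (v i) (k i)) :
    DeltaCorrelationExists (∏ i ∈ s, v i) (∏ i ∈ s, k i) := by
  induction s using Finset.cons_induction with
  | empty => simpa using one
  | cons i s hi ih =>
    rw [forall_mem_cons] at h
    simpa only [prod_cons] using h.1.mul (ih h.2)

theorem two_of_odd {p : ℕ} (hp : 1 < p) (hodd : Odd p) : DeltaCorrelationExists p 2 :=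
  have : Fact (1 < p) := ⟨hp⟩
  ⟨ZMod p, inferInstance, inferInstance, _, _, ZMod.card p,
    card_pair (neg_ne_zero.mpr one_ne_zero).symm, hasDeltaCorrelation_zmod hodd⟩

theorem of_correlation_self {G : Type} [AddCommGroup G] [Fintype G] {k : ℕ}
    (hG : Fintype.card G + 1 = 2 * k) {f : G → ℤ} (hf : ∀ x, IsUnit (f x)) (hsum : ∑ x, f x = 1)
    (hcorr : ∀ g ≠ 0, correlation f f g = -1) :
    DeltaCorrelationExists (Fintype.card G) k := by
  have hcard := two_mul_card_filter_eq_one (s := univ) fun x _ => hf x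
  rw [hsum, card_univ] at hcard
  exact ⟨G, inferInstance, inferInstance, _, f, rfl, by omega,
    hasDeltaCorrelation_of_correlation_self hf hsum hcorr⟩

theorem gsedfExists {v lam : ℕ} (h : DeltaCorrelationExists v (2 * lam)) (hlam : 0 < lam) :
    GSEDFExists v 2 ![2 * lam, (v - 1) / 2] ![lam, lam] := by
  classical
  obtain ⟨G, _, _, A, f, rfl, hA, hf⟩ := h
  exact ⟨G, inferInstance, inferInstance, inferInstance, _, hf.isGSEDF hA hlam⟩

end DeltaCorrelationExists

theorem exists_field_of_isPrimePow {q : ℕ} (hq : IsPrimePow q) :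
    ∃ (F : Type) (_ : Field F) (_ : Fintype F), Fintype.card F = q := by
  obtain ⟨field⟩ : Nonempty (Field (Fin q)) :=
    Fintype.nonempty_field_iff.mpr (by rwa [Fintype.card_fin])
  exact ⟨Fin q, field, inferInstance, Fintype.card_fin q⟩

theorem deltaCorrelationExists_of_isPrimePow {v m : ℕ} (hvm : v + 1 = 4 * m)
    (hv : IsPrimePow v) : DeltaCorrelationExists v (2 * m) := by
  classical
  obtain ⟨F, _, _, rfl⟩ := exists_field_of_isPrimePow hv
  have hchar : ringChar F ≠ 2 := ringChar_ne_two_of_odd_card (Nat.odd_iff.mpr (by omega))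
  exact .of_correlation_self (by omega) isUnit_paleySign (sum_paleySign hchar) fun _ hg =>
    correlation_paleySign (by omega) hg

theorem deltaCorrelationExists_of_isPrimePow_twin {q m : ℕ} (hqm : q * (q + 2) + 1 = 4 * m)
    (hq : IsPrimePow q) (hq2 : IsPrimePow (q + 2)) :
    DeltaCorrelationExists (q * (q + 2)) (2 * m) := by
  classical
  obtain ⟨F, _, _, rfl⟩ := exists_field_of_isPrimePow hq
  obtain ⟨K, _, _, hK⟩ := exists_field_of_isPrimePow hq2
  have hodd : Odd (Fintype.card F) := Nat.Odd.of_mul_left (n := Fintype.card F + 2) <|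
    Nat.odd_iff.mpr (by omega)
  rw [← hK, ← Fintype.card_prod] at hqm ⊢
  exact .of_correlation_self (by omega) isUnit_twinSign
    (sum_twinSign (ringChar_ne_two_of_odd_card hodd) hK) fun _ hg =>
    correlation_twinSign hodd hK hg

theorem mainTheorem10 (m t n : ℕ) (hm : 0 < m)
    (ht : (t = 1 ∧ n = 0) ∨
      ∃ p : Fin n → ℕ, (∀ i, 1 < p i ∧ Odd (p i)) ∧ t = ∏ i, p i)
    (hv : IsPrimePow (4 * m - 1) ∨
      ∃ q : ℕ, IsPrimePow q ∧ IsPrimePow (q + 2) ∧ 4 * m - 1 = q * (q + 2)) :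
    GSEDFExists ((4 * m - 1) * t) 2
      ![m * 2 ^ (n + 1), (4 * m * t - t - 1) / 2] ![m * 2 ^ n, m * 2 ^ n] := by
  have base : DeltaCorrelationExists (4 * m - 1) (2 * m) := by
    rcases hv with hv | ⟨q, hq, hq2, hv⟩
    · exact deltaCorrelationExists_of_isPrimePow (by omega) hv
    · rw [hv]
      exact deltaCorrelationExists_of_isPrimePow_twin (by omega) hq hq2
  have factor : DeltaCorrelationExists t (2 ^ n) := by
    rcases ht with ⟨rfl, rfl⟩ | ⟨p, hp, rfl⟩
    · exact .one
    · simpa using DeltaCorrelationExists.finset_prod univ fun i _ =>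
        DeltaCorrelationExists.two_of_odd (hp i).1 (hp i).2
  have gsedf := (mul_assoc 2 m (2 ^ n) ▸ base.mul factor).gsedfExists (by positivity)
  rw [pow_succ', mul_left_comm m, ← Nat.sub_one_mul]
  exact gsedf
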